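/- Let $q,\alpha,\beta,s,t$ be complex numbers with $\max\{|q|,|\alpha|,|\beta|,|s|,|t|\}<1$. Write $(a;q)_0=1$, $(a;q)_n=\prod_{k=0}^{n-1}(1-aq^k)$ for $n\ge 1$, $(a;q)_\infty=\prod_{k=0}^{\infty}(1-aq^k)$, and $(a_1,\dots,a_m;q)_\infty=\prod_{j=1}^m (a_j;q)_\infty$. Then \[ \int_{0}^{2\pi}\frac{(\alpha t e^{i\theta},\beta t e^{-i\theta},\alpha s e^{i\theta},\beta s e^{-i\theta}, e^{2i\theta}, e^{-2i\theta};q)_\infty} {(t e^{i\theta}, t e^{-i\theta}, s e^{i\theta}, s e^{-i\theta}, \alpha e^{2i\theta}, \beta e^{-2i\theta};q)_\infty}\,d\theta =\frac{2\pi(\alpha,\beta;q)_\infty}{(q,\alpha\beta;q)_\infty} \sum_{n=0}^{\infty}\left(\frac{1}{1-\alpha q^n}+\frac{1}{1-\beta q^n}\right)\frac{(\alpha\beta;q)_n}{(q;q)_n}(st)^n, \] where the integrand is integrable on $[0,2\pi]$ and the series on the right converges absolutely. -/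

import Mathlib

/-- The finite `q`-shifted factorial `(a;q)_n = ∏_{k=0}^{n-1} (1 - a q^k)`. -/
noncomputable def qPoch (a q : ℂ) (n : ℕ) : ℂ :=
  ∏ k ∈ Finset.range n, (1 - a * q ^ k)

/-- The infinite `q`-shifted factorial `(a;q)_∞ = ∏_{k=0}^∞ (1 - a q^k)`, for `|q| < 1`. -/
noncomputable def qPochInf (a q : ℂ) : ℂ :=
  ∏' k : ℕ, (1 - a * q ^ k)

/-- The product defining `(a;q)_∞` converges for `|q| < 1`. -/
theorem multipliable_qPochInf (a : ℂ) {q : ℂ} (hq : ‖q‖ < 1) :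
    Multipliable fun k : ℕ => 1 - a * q ^ k := by
  have h : Summable fun k : ℕ => ‖-(a * q ^ k)‖ := by
    simp only [norm_neg, norm_mul, norm_pow]
    exact (summable_geometric_of_lt_one (norm_nonneg q) hq).mul_left _
  simpa [sub_eq_add_neg] using multipliable_one_add_of_summable h

/-- The integrand of the `q`-beta integral, with `e = exp(iθ)` and `f = exp(-iθ)`. -/
noncomputable def qBetaIntegrand (q α β s t : ℂ) (θ : ℝ) : ℂ :=
  let e : ℂ := Complex.exp (Complex.I * θ)
  let f : ℂ := Complex.exp (-(Complex.I * θ))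
  (qPochInf (α * t * e) q * qPochInf (β * t * f) q * qPochInf (α * s * e) q *
      qPochInf (β * s * f) q * qPochInf (e ^ 2) q * qPochInf (f ^ 2) q) /
    (qPochInf (t * e) q * qPochInf (t * f) q * qPochInf (s * e) q *
      qPochInf (s * f) q * qPochInf (α * e ^ 2) q * qPochInf (β * f ^ 2) q)

/-- The `n`-th term of the series on the right-hand side. -/
noncomputable def qBetaTerm (q α β s t : ℂ) (n : ℕ) : ℂ :=
  (1 / (1 - α * q ^ n) + 1 / (1 - β * q ^ n)) * (qPoch (α * β) q n / qPoch q q n) * (s * t) ^ n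

/-! The integrand is a product of two generating functions and a weight. By the `q`-binomial
theorem, the factors in `t` equal `∑ t ^ n * trigPoly q α β n`, the factors in `s` equal the same
series in `s`, and what remains is `qWeight`, which depends on neither. The theorem then amounts to
orthogonality of the polynomials `trigPoly` for the bilinear pairing (no conjugation) given by
`qWeight`: in the double sum only the diagonal survives, and its `n`-th entry is a constant times
the `n`-th term of the series (`integral_trigPoly_mul_of_ne`, `integral_trigPoly_mul_self`).

Orthogonality is a statement about Fourier coefficients. Those of `qPsi` satisfy a first-order
recurrence (`qBinCorr_succ`), and the moments of `trigPoly` against `qPsi` are the finite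
convolutions `qBinConv`. A three-term recurrence in `n` shows that these vanish for `1 ≤ j ≤ n`
(`qBinConv_eq_zero`) and have product formulas for `j ≤ 0` and `j > n` (`qBinConv_neg`,
`qBinConv_add`). On the diagonal just the two boundary moments `j = 0` and `j = n + 1` remain; they
produce the two fractions in the summand. The overall constant is a `q`-Gauss sum (`qBinCorr_eq`).
-/

open Filter Topology

/-! ### The `q`-binomial theorem. -/

/-- The coefficient of `x ^ k` in the expansion of `(b x; q)_∞ / (a x; q)_∞`. -/
noncomputable def qBinCoeff (q a b : ℂ) (k : ℕ) : ℂ :=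
  (∏ i ∈ Finset.range k, (a - b * q ^ i)) / qPoch q q k

theorem one_sub_mul_pow_ne_zero {q a : ℂ} (hq : ‖q‖ < 1) (ha : ‖a‖ < 1) (k : ℕ) :
    1 - a * q ^ k ≠ 0 := by
  intro h
  have h1 : ‖a * q ^ k‖ = 1 := by rw [← sub_eq_zero.1 h, norm_one]
  rw [norm_mul, norm_pow] at h1
  have h2 : ‖q‖ ^ k ≤ 1 := pow_le_one₀ (norm_nonneg q) hq.le
  nlinarith [norm_nonneg a, norm_nonneg q]

theorem one_sub_pow_succ_ne_zero {q : ℂ} (hq : ‖q‖ < 1) (k : ℕ) : 1 - q ^ (k + 1) ≠ 0 := by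
  rw [pow_succ']
  exact one_sub_mul_pow_ne_zero hq hq k

theorem qPoch_ne_zero {q a : ℂ} (hq : ‖q‖ < 1) (ha : ‖a‖ < 1) (n : ℕ) : qPoch a q n ≠ 0 :=
  Finset.prod_ne_zero_iff.2 fun k _ => one_sub_mul_pow_ne_zero hq ha k

theorem qPoch_zero (a q : ℂ) : qPoch a q 0 = 1 := by simp [qPoch]

theorem qPoch_succ (a q : ℂ) (n : ℕ) : qPoch a q (n + 1) = qPoch a q n * (1 - a * q ^ n) := by
  simp [qPoch, Finset.prod_range_succ]

theorem tendsto_qPoch (a : ℂ) {q : ℂ} (hq : ‖q‖ < 1) :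
    Tendsto (qPoch a q) atTop (𝓝 (qPochInf a q)) :=
  (multipliable_qPochInf a hq).tendsto_prod_tprod_nat

theorem qPochInf_eq_one_sub_mul (a : ℂ) {q : ℂ} (hq : ‖q‖ < 1) :
    qPochInf a q = (1 - a) * qPochInf (q * a) q := by
  have h := multipliable_qPochInf (q * a) hq
  have e : (fun k : ℕ => 1 - q * a * q ^ k) = fun k : ℕ => 1 - a * q ^ (k + 1) := by
    ext k; ring
  unfold qPochInf
  rw [e] at h ⊢
  rw [tprod_eq_zero_mul' (f := fun k : ℕ => 1 - a * q ^ k) h]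
  simp

theorem qBinCoeff_zero (q a b : ℂ) : qBinCoeff q a b 0 = 1 := by simp [qBinCoeff, qPoch]

theorem qBinCoeff_one (q a b : ℂ) : qBinCoeff q a b 1 = (a - b) / (1 - q) := by
  simp [qBinCoeff, qPoch]

theorem qBinCoeff_succ {q : ℂ} (hq : ‖q‖ < 1) (a b : ℂ) (k : ℕ) :
    (1 - q ^ (k + 1)) * qBinCoeff q a b (k + 1) = (a - b * q ^ k) * qBinCoeff q a b k := by
  have h1 := one_sub_pow_succ_ne_zero hq k
  have h2 := qPoch_ne_zero hq hq k
  rw [qBinCoeff, qBinCoeff, qPoch_succ, Finset.prod_range_succ, ← pow_succ']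
  field_simp

/-- Homogeneity lets the pair `(a, b)` absorb the variable of the power series; nothing is divided
by `a`, so `a = 0` stays admissible. -/
theorem qBinCoeff_mul (q a b x : ℂ) (k : ℕ) :
    qBinCoeff q (a * x) (b * x) k = qBinCoeff q a b k * x ^ k := by
  have : ∀ i, a * x - b * x * q ^ i = (a - b * q ^ i) * x := fun i => by ring
  simp only [qBinCoeff, this, Finset.prod_mul_distrib, Finset.prod_const, Finset.card_range]
  ring

theorem qBinCoeff_one_left (q b : ℂ) (k : ℕ) :
    qBinCoeff q 1 b k = qPoch b q k / qPoch q q k := rfl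

theorem summable_norm_qBinCoeff {q a : ℂ} (hq : ‖q‖ < 1) (ha : ‖a‖ < 1) (b : ℂ) :
    Summable fun k => ‖qBinCoeff q a b k‖ := by
  obtain ⟨r, har, hr⟩ := exists_between ha
  refine summable_of_ratio_norm_eventually_le hr ?_
  have hq0 : Tendsto (fun k : ℕ => q ^ k) atTop (𝓝 0) :=
    tendsto_pow_atTop_nhds_zero_of_norm_lt_one hq
  have hq1 : Tendsto (fun k : ℕ => q ^ (k + 1)) atTop (𝓝 0) := hq0.comp (tendsto_add_atTop_nat 1)
  have hlim : Tendsto (fun k : ℕ => ‖(a - b * q ^ k) / (1 - q ^ (k + 1))‖) atTop (𝓝 ‖a‖) := by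
    have := ((tendsto_const_nhds (x := a)).sub (hq0.const_mul b)).div
      ((tendsto_const_nhds (x := (1 : ℂ))).sub hq1) (by simp)
    simpa using this.norm
  filter_upwards [hlim.eventually_lt_const har] with k hk
  have h1 := one_sub_pow_succ_ne_zero hq k
  have : qBinCoeff q a b (k + 1) = (a - b * q ^ k) / (1 - q ^ (k + 1)) * qBinCoeff q a b k := by
    rw [div_mul_eq_mul_div, eq_div_iff h1, ← qBinCoeff_succ hq]; ring
  rw [norm_norm, norm_norm, this, norm_mul]
  gcongr

theorem summable_qBinCoeff {q a : ℂ} (hq : ‖q‖ < 1) (ha : ‖a‖ < 1) (b : ℂ) :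
    Summable (qBinCoeff q a b) := (summable_norm_qBinCoeff hq ha b).of_norm

theorem tsum_eq_zero_add_nat {f : ℕ → ℂ} (hf : Summable f) :
    ∑' k, f k = f 0 + ∑' k, f (k + 1) := hf.tsum_eq_zero_add

/-- The functional equation `(1 - a) S(a, b) = (1 - b) S(a q, b q)` of the `q`-binomial series. -/
theorem tsum_qBinCoeff_shift {q a : ℂ} (hq : ‖q‖ < 1) (ha : ‖a‖ < 1) (b : ℂ) :
    (1 - a) * ∑' k, qBinCoeff q a b k = (1 - b) * ∑' k, qBinCoeff q (a * q) (b * q) k := by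
  have haq : ‖a * q‖ < 1 := by
    rw [norm_mul]; nlinarith [norm_nonneg a, norm_nonneg q]
  have h0 := summable_qBinCoeff hq ha b
  have h1 := summable_qBinCoeff hq haq (b * q)
  have h0' := (summable_nat_add_iff 1).2 h0
  have h1' := (summable_nat_add_iff 1).2 h1
  have key : ∑' k, qBinCoeff q a b (k + 1) - ∑' k, qBinCoeff q (a * q) (b * q) (k + 1) =
      a * ∑' k, qBinCoeff q a b k - b * ∑' k, qBinCoeff q (a * q) (b * q) k := by
    rw [← h0'.tsum_sub h1', ← tsum_mul_left, ← tsum_mul_left,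
      ← (h0.mul_left a).tsum_sub (h1.mul_left b)]
    refine tsum_congr fun k => ?_
    rw [qBinCoeff_mul, qBinCoeff_mul]
    linear_combination qBinCoeff_succ hq a b k
  have e0 := tsum_eq_zero_add_nat h0
  have e1 := tsum_eq_zero_add_nat h1
  rw [qBinCoeff_zero] at e0 e1
  linear_combination e0 - e1 + key

theorem norm_mul_pow_lt_one {q a : ℂ} (hq : ‖q‖ < 1) (ha : ‖a‖ < 1) (n : ℕ) :
    ‖a * q ^ n‖ < 1 := by
  rw [norm_mul, norm_pow]
  have h2 : ‖q‖ ^ n ≤ 1 := pow_le_one₀ (norm_nonneg q) hq.le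
  nlinarith [norm_nonneg a, norm_nonneg q]

theorem qPoch_mul_tsum_qBinCoeff {q a : ℂ} (hq : ‖q‖ < 1) (ha : ‖a‖ < 1) (b : ℂ) (n : ℕ) :
    qPoch a q n * ∑' k, qBinCoeff q a b k =
      qPoch b q n * ∑' k, qBinCoeff q (a * q ^ n) (b * q ^ n) k := by
  induction n with
  | zero => simp [qPoch_zero]
  | succ n ih =>
    have h := tsum_qBinCoeff_shift hq (norm_mul_pow_lt_one hq ha n) (b * q ^ n)
    rw [qPoch_succ, qPoch_succ, pow_succ, ← mul_assoc, ← mul_assoc]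
    linear_combination (1 - a * q ^ n) * ih + qPoch b q n * h

/-- Iterating the functional equation sends the parameters to `a * q ^ n`, `b * q ^ n`; as `n → ∞`
only the term `k = 0` of the series survives. -/
theorem qPochInf_mul_tsum_qBinCoeff {q a : ℂ} (hq : ‖q‖ < 1) (ha : ‖a‖ < 1) (b : ℂ) :
    qPochInf a q * ∑' k, qBinCoeff q a b k = qPochInf b q := by
  have hlim : Tendsto (fun n : ℕ => ∑' k, qBinCoeff q (a * q ^ n) (b * q ^ n) k) atTop
      (𝓝 (∑' k, if k = 0 then (1 : ℂ) else 0)) := by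
    refine tendsto_tsum_of_dominated_convergence (summable_norm_qBinCoeff hq ha b) ?_ ?_
    · intro k
      rcases Nat.eq_zero_or_pos k with rfl | hk
      · simp [qBinCoeff_zero]
      · have h0 : Tendsto (fun n : ℕ => (q ^ k) ^ n) atTop (𝓝 0) :=
          tendsto_pow_atTop_nhds_zero_of_norm_lt_one
            (by rw [norm_pow]; exact pow_lt_one₀ (norm_nonneg q) hq hk.ne')
        have := h0.const_mul (qBinCoeff q a b k)
        simpa [qBinCoeff_mul, hk.ne', ← pow_mul, mul_comm k] using this
    · refine Eventually.of_forall fun n k => ?_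
      rw [qBinCoeff_mul, norm_mul, norm_pow, norm_pow]
      exact mul_le_of_le_one_right (norm_nonneg _)
        (pow_le_one₀ (by positivity) (pow_le_one₀ (norm_nonneg q) hq.le))
  rw [tsum_ite_eq] at hlim
  have h1 := (tendsto_qPoch b hq).mul hlim
  have h2 := (tendsto_qPoch a hq).mul_const (∑' k, qBinCoeff q a b k)
  simp only [qPoch_mul_tsum_qBinCoeff hq ha b] at h2
  rw [tendsto_nhds_unique h2 h1, mul_one]

theorem qPochInf_zero (q : ℂ) : qPochInf 0 q = 1 := by simp [qPochInf]

theorem qPochInf_ne_zero {q a : ℂ} (hq : ‖q‖ < 1) (ha : ‖a‖ < 1) : qPochInf a q ≠ 0 := by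
  intro h
  -- With `b = 0` the series is an inverse of `(a;q)_∞`.
  have := qPochInf_mul_tsum_qBinCoeff hq ha 0
  rw [h, zero_mul, qPochInf_zero] at this
  exact zero_ne_one this

/-- The `q`-binomial theorem, in homogeneous form. -/
theorem qPochInf_div {q a : ℂ} (hq : ‖q‖ < 1) (ha : ‖a‖ < 1) (b : ℂ) {x : ℂ} (hx : ‖x‖ = 1) :
    qPochInf (b * x) q / qPochInf (a * x) q = ∑' k, qBinCoeff q a b k * x ^ k := by
  have hax : ‖a * x‖ < 1 := by rwa [norm_mul, hx, mul_one]
  rw [div_eq_iff (qPochInf_ne_zero hq hax), ← qPochInf_mul_tsum_qBinCoeff hq hax, mul_comm]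
  simp only [qBinCoeff_mul]

/-! ### Correlations of coefficient sequences and a `q`-Gauss sum. -/

/-- The correlation `∑ l, d (l + m) d' l` of two `q`-binomial coefficient sequences. -/
noncomputable def qBinCorr (q a b a' b' : ℂ) (m : ℕ) : ℂ :=
  ∑' l, qBinCoeff q a b (l + m) * qBinCoeff q a' b' l

theorem summable_mul_of_norm {f g : ℕ → ℂ} (hf : Summable fun k => ‖f k‖)
    (hg : Summable fun k => ‖g k‖) : Summable fun k => f k * g k := by
  have h : Summable fun k => ‖f k‖ * ‖g k‖ :=
    hf.mul_of_nonneg hg (fun _ => norm_nonneg _) (fun _ => norm_nonneg _) |>.comp_injective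
      (i := fun k : ℕ => (k, k)) fun a b h => (Prod.mk.inj h).1
  refine Summable.of_norm ?_
  simpa only [norm_mul] using h

theorem summable_qBinCorr {q a a' : ℂ} (hq : ‖q‖ < 1) (ha : ‖a‖ < 1) (ha' : ‖a'‖ < 1)
    (b b' : ℂ) (m n : ℕ) :
    Summable fun l => qBinCoeff q a b (l + m) * qBinCoeff q a' b' (l + n) :=
  summable_mul_of_norm ((summable_nat_add_iff m).2 (summable_norm_qBinCoeff hq ha b))
    ((summable_nat_add_iff n).2 (summable_norm_qBinCoeff hq ha' b'))

/-- Formally, put `f(u) = (b u, b' / u; q)_∞ / (a u, a' / u; q)_∞` and compare `f(q u)` with `f(u)`.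
The condition `b * b' = q` makes the factor `1 - b u` cancel, leaving `(1 - a u) f(u) = (a' b / q -
b u) f(q u)`, whose coefficients give a two-term recurrence. The proof works on coefficients, so
convergence at `q u` is not needed. -/
theorem qBinCorr_succ {q a b a' b' : ℂ} (hq : ‖q‖ < 1) (ha : ‖a‖ < 1) (ha' : ‖a'‖ < 1)
    (hb : b * b' = q) (m : ℕ) :
    qBinCorr q a b a' b' (m + 1) * (1 - a' * b * q ^ m) =
      qBinCorr q a b a' b' m * (a - b * q ^ m) := by
  set d := qBinCoeff q a b
  set d' := qBinCoeff q a' b'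
  have s0 : Summable fun l => d (l + m) * d' l := summable_qBinCorr hq ha ha' b b' m 0
  have s1 : Summable fun l => d (l + (m + 1)) * d' l := summable_qBinCorr hq ha ha' b b' (m + 1) 0
  have s2 : Summable fun l => d (l + (m + 1)) * d' (l + 1) :=
    summable_qBinCorr hq ha ha' b b' (m + 1) 1
  have hpow : ∀ l : ℕ, ‖q ^ l‖ ≤ 1 := fun l => by
    rw [norm_pow]; exact pow_le_one₀ (norm_nonneg q) hq.le
  have s3 : Summable fun l => q ^ (l + m) * d (l + m) * d' l := by
    refine Summable.of_norm_bounded s0.norm fun l => ?_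
    rw [mul_assoc, norm_mul]
    exact mul_le_of_le_one_left (norm_nonneg _) (hpow _)
  have s4 : Summable fun l => q ^ (l + (m + 1)) * d (l + (m + 1)) * d' l := by
    refine Summable.of_norm_bounded s1.norm fun l => ?_
    rw [mul_assoc, norm_mul]
    exact mul_le_of_le_one_left (norm_nonneg _) (hpow _)
  have e0 : ∑' l, d (l + m) * d' l = d m * d' 0 + ∑' l, d (l + (m + 1)) * d' (l + 1) := by
    rw [tsum_eq_zero_add_nat s0, zero_add]
    simp only [add_assoc, add_comm 1 m]
  have e3 : ∑' l, q ^ (l + m) * d (l + m) * d' l =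
      q ^ m * d m * d' 0 + ∑' l, q ^ (l + (m + 1)) * d (l + (m + 1)) * d' (l + 1) := by
    rw [tsum_eq_zero_add_nat s3, zero_add]
    simp only [add_assoc, add_comm 1 m]
  have s5 : Summable fun l => q ^ (l + (m + 1)) * d (l + (m + 1)) * d' (l + 1) := by
    refine Summable.of_norm_bounded s2.norm fun l => ?_
    rw [mul_assoc, norm_mul]
    exact mul_le_of_le_one_left (norm_nonneg _) (hpow _)
  have k1 : ∑' l, d (l + (m + 1)) * d' l - a * ∑' l, d (l + m) * d' l =
      ∑' l, q ^ (l + (m + 1)) * d (l + (m + 1)) * d' l -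
        b * ∑' l, q ^ (l + m) * d (l + m) * d' l := by
    rw [← tsum_mul_left, ← tsum_mul_left, ← s1.tsum_sub (s0.mul_left a),
      ← s4.tsum_sub (s3.mul_left b)]
    refine tsum_congr fun l => ?_
    have := qBinCoeff_succ hq a b (l + m)
    rw [add_assoc] at this
    linear_combination d' l * this
  have k2 : ∑' l, q ^ (l + (m + 1)) * d (l + (m + 1)) * d' l -
      b * ∑' l, q ^ (l + (m + 1)) * d (l + (m + 1)) * d' (l + 1) =
      q ^ m * b * (a' * ∑' l, d (l + (m + 1)) * d' l - ∑' l, d (l + (m + 1)) * d' (l + 1)) := by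
    rw [← tsum_mul_left, ← tsum_mul_left, ← s4.tsum_sub (s5.mul_left b),
      ← (s1.mul_left a').tsum_sub s2, ← tsum_mul_left]
    refine tsum_congr fun l => ?_
    have h := qBinCoeff_succ hq a' b' l
    change (1 - q ^ (l + 1)) * d' (l + 1) = (a' - b' * q ^ l) * d' l at h
    linear_combination q ^ m * d (l + (m + 1)) * b * h - q ^ m * d (l + (m + 1)) * q ^ l * d' l * hb
  change (∑' l, d (l + (m + 1)) * d' l) * (1 - a' * b * q ^ m) =
    (∑' l, d (l + m) * d' l) * (a - b * q ^ m)
  linear_combination k1 + k2 - b * e3 + b * q ^ m * e0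

theorem qBinCorr_zero_swap (q a b a' b' : ℂ) :
    qBinCorr q a b a' b' 0 = qBinCorr q a' b' a b 0 := by
  simp only [qBinCorr, add_zero, mul_comm]

/-- A majorant uniform in `a`, for dominated convergence: with `b = -1` and nonnegative real `q`,
`a`, the triangle inequality in each numerator factor is an equality. -/
theorem norm_qBinCoeff_le {q a b : ℂ} (hq : ‖q‖ < 1) {r : ℝ} (ha : ‖a‖ ≤ r) (hb : ‖b‖ ≤ 1)
    (k : ℕ) : ‖qBinCoeff q a b k‖ ≤ ‖qBinCoeff (‖q‖ : ℂ) (r : ℂ) (-1) k‖ := by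
  have hr : 0 ≤ r := (norm_nonneg a).trans ha
  have hqn : ‖((‖q‖ : ℝ) : ℂ)‖ < 1 := by simpa using hq
  induction k with
  | zero => simp [qBinCoeff_zero]
  | succ k ih =>
    have e : ∀ {p : ℂ} (_ : ‖p‖ < 1) (a b : ℂ), ‖qBinCoeff p a b (k + 1)‖ =
        ‖a - b * p ^ k‖ / ‖1 - p ^ (k + 1)‖ * ‖qBinCoeff p a b k‖ := by
      intro p hp a b
      have h1 := one_sub_pow_succ_ne_zero hp k
      rw [← norm_div, ← norm_mul, div_mul_eq_mul_div, ← qBinCoeff_succ hp,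
        mul_div_cancel_left₀ _ h1]
    rw [e hq, e hqn]
    have hp : ‖q‖ ^ (k + 1) < 1 := pow_lt_one₀ (norm_nonneg q) hq (by omega)
    have n1 : ‖(r : ℂ) - -1 * (‖q‖ : ℂ) ^ k‖ = r + ‖q‖ ^ k := by
      have : (r : ℂ) - -1 * (‖q‖ : ℂ) ^ k = ((r + ‖q‖ ^ k : ℝ) : ℂ) := by push_cast; ring
      rw [this, Complex.norm_real, Real.norm_of_nonneg (by positivity)]
    have n2 : ‖1 - (‖q‖ : ℂ) ^ (k + 1)‖ = 1 - ‖q‖ ^ (k + 1) := by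
      have : 1 - (‖q‖ : ℂ) ^ (k + 1) = ((1 - ‖q‖ ^ (k + 1) : ℝ) : ℂ) := by push_cast; ring
      rw [this, Complex.norm_real, Real.norm_of_nonneg (by linarith)]
    rw [n1, n2]
    have m1 : ‖a - b * q ^ k‖ ≤ r + ‖q‖ ^ k := by
      refine (norm_sub_le _ _).trans (add_le_add ha ?_)
      rw [norm_mul, norm_pow]
      exact mul_le_of_le_one_left (by positivity) hb
    have m2 : 1 - ‖q‖ ^ (k + 1) ≤ ‖1 - q ^ (k + 1)‖ := by
      have := norm_sub_norm_le (1 : ℂ) (q ^ (k + 1))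
      rwa [norm_one, norm_pow] at this
    have : 0 < 1 - ‖q‖ ^ (k + 1) := by linarith
    gcongr

theorem qBinCoeff_shift_left {q : ℂ} (hq : ‖q‖ < 1) (a b : ℂ) (k : ℕ) :
    qBinCoeff q (a * q) b (k + 1) = qBinCoeff q a b (k + 1) - a * qBinCoeff q a b k := by
  have h1 := one_sub_pow_succ_ne_zero hq k
  have h2 := qPoch_ne_zero hq hq k
  have e : ∏ i ∈ Finset.range (k + 1), (a * q - b * q ^ i) =
      (a * q - b) * (q ^ k * ∏ i ∈ Finset.range k, (a - b * q ^ i)) := by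
    have : ∀ i, a * q - b * q ^ (i + 1) = q * (a - b * q ^ i) := fun i => by ring
    rw [Finset.prod_range_succ']
    simp only [this, Finset.prod_mul_distrib, Finset.prod_const, Finset.card_range]
    ring
  rw [qBinCoeff, qBinCoeff, qBinCoeff, e, qPoch_succ, Finset.prod_range_succ, ← pow_succ']
  field_simp
  ring

/-- A contiguous relation: `qBinCoeff_shift_left` expresses the correlation at `α * q` by those of
orders `0` and `1` at `α`, and `qBinCorr_succ` eliminates order `1`. -/
theorem qBinCorr_zero_shift {q α β : ℂ} (hq : ‖q‖ < 1) (hα : ‖α‖ < 1) (hβ : ‖β‖ < 1) :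
    (1 - α * q) * qBinCorr q (α * q) 1 β q 0 = (1 - α * β) * qBinCorr q α 1 β q 0 := by
  have hαq : ‖α * q‖ < 1 := by simpa using norm_mul_pow_lt_one hq hα 1
  have h := qBinCorr_succ hq hβ hα (mul_one q) 0
  rw [qBinCorr_zero_swap q β q] at h
  have s0 := summable_qBinCorr hq hαq hβ 1 q 0 0
  have s1 := summable_qBinCorr hq hα hβ 1 q 0 0
  have s2 := summable_qBinCorr hq hα hβ 1 q 0 1
  have s3 := summable_qBinCorr hq hα hβ 1 q 1 1
  simp only [add_zero] at s0 s1 s2 s3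
  have k : qBinCorr q (α * q) 1 β q 0 =
      qBinCorr q α 1 β q 0 - α * qBinCorr q β q α 1 1 := by
    have e : qBinCorr q β q α 1 1 = ∑' l, qBinCoeff q α 1 l * qBinCoeff q β q (l + 1) := by
      simp only [qBinCorr, mul_comm]
    rw [e, qBinCorr, qBinCorr]
    simp only [add_zero]
    rw [tsum_eq_zero_add_nat s0, tsum_eq_zero_add_nat s1, add_sub_assoc, ← tsum_mul_left,
      ← s3.tsum_sub (s2.mul_left α)]
    simp only [qBinCoeff_zero, qBinCoeff_shift_left hq]
    congr 1
    exact tsum_congr fun l => by ring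
  rw [zero_add, pow_zero, mul_one] at h
  linear_combination (1 - α * q) * k - α * h

theorem qPoch_mul_qBinCorr {q α β : ℂ} (hq : ‖q‖ < 1) (hα : ‖α‖ < 1) (hβ : ‖β‖ < 1) (n : ℕ) :
    qPoch (α * q) q n * qBinCorr q (α * q ^ n) 1 β q 0 =
      qPoch (α * β) q n * qBinCorr q α 1 β q 0 := by
  induction n with
  | zero => simp [qPoch_zero]
  | succ n ih =>
    have h := qBinCorr_zero_shift hq (norm_mul_pow_lt_one hq hα n) hβ
    rw [qPoch_succ, qPoch_succ, pow_succ, ← mul_assoc]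
    linear_combination qPoch (α * q) q n * h + (1 - α * β * q ^ n) * ih

theorem qPochInf_mul_qBinCorr {q α β : ℂ} (hq : ‖q‖ < 1) (hα : ‖α‖ < 1) (hβ : ‖β‖ < 1) :
    qPochInf (α * q) q * qBinCorr q 0 1 β q 0 =
      qPochInf (α * β) q * qBinCorr q α 1 β q 0 := by
  have hlim : Tendsto (fun n : ℕ => qBinCorr q (α * q ^ n) 1 β q 0) atTop
      (𝓝 (qBinCorr q 0 1 β q 0)) := by
    have hqn : ‖((‖q‖ : ℝ) : ℂ)‖ < 1 := by simpa using hq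
    have hαn : ‖((‖α‖ : ℝ) : ℂ)‖ < 1 := by simpa using hα
    have hbd : Summable fun l =>
        ‖qBinCoeff (‖q‖ : ℂ) (‖α‖ : ℂ) (-1) l‖ * ‖qBinCoeff q β q l‖ := by
      have := (summable_mul_of_norm (summable_norm_qBinCoeff hqn hαn (-1))
        (summable_norm_qBinCoeff hq hβ q)).norm
      simpa only [norm_mul] using this
    refine tendsto_tsum_of_dominated_convergence hbd ?_ ?_
    · intro l
      refine Tendsto.mul_const _ ?_
      have hc : Continuous fun a : ℂ => qBinCoeff q a 1 (l + 0) := by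
        unfold qBinCoeff; fun_prop
      have h0 : Tendsto (fun n : ℕ => α * q ^ n) atTop (𝓝 0) := by
        simpa using (tendsto_pow_atTop_nhds_zero_of_norm_lt_one hq).const_mul α
      exact (hc.tendsto 0).comp h0
    · refine Eventually.of_forall fun n l => ?_
      rw [norm_mul, add_zero]
      refine mul_le_mul_of_nonneg_right (norm_qBinCoeff_le hq ?_ (by simp) l) (norm_nonneg _)
      rw [norm_mul, norm_pow]
      exact mul_le_of_le_one_right (norm_nonneg _) (pow_le_one₀ (norm_nonneg q) hq.le)
  have h1 := (tendsto_qPoch (α * q) hq).mul hlim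
  have h2 := (tendsto_qPoch (α * β) hq).mul_const (qBinCorr q α 1 β q 0)
  simp only [← qPoch_mul_qBinCorr hq hα hβ] at h2
  exact tendsto_nhds_unique h1 h2

theorem qBinCorr_self {q β : ℂ} (hq : ‖q‖ < 1) :
    qBinCorr q q 1 β q 0 = (1 - β) / (1 - q) := by
  have h1 : 1 - q ≠ 0 := by simpa using one_sub_pow_succ_ne_zero hq 0
  have hz : ∀ l, l ∉ Finset.range 2 →
      qBinCoeff q q 1 (l + 0) * qBinCoeff q β q l = 0 := by
    intro l hl
    -- The factor `i = 1` is `q - q`, so the series stops after two terms.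
    have : ∏ i ∈ Finset.range l, (q - 1 * q ^ i) = 0 :=
      Finset.prod_eq_zero (i := 1) (by simp at hl ⊢; omega) (by ring)
    rw [add_zero, qBinCoeff, this, zero_div, zero_mul]
  rw [qBinCorr, tsum_eq_sum hz]
  simp only [Finset.sum_range_succ, Finset.sum_range_zero, add_zero, qBinCoeff_zero,
    qBinCoeff_one]
  field_simp
  ring

/-- A `q`-Gauss summation. -/
theorem qBinCorr_eq {q α β : ℂ} (hq : ‖q‖ < 1) (hα : ‖α‖ < 1) (hβ : ‖β‖ < 1) :
    qPochInf q q * qPochInf (α * β) q * qBinCorr q α 1 β q 0 =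
      qPochInf (q * α) q * qPochInf β q := by
  have h1 : 1 - q ≠ 0 := by simpa using one_sub_pow_succ_ne_zero hq 0
  -- The unknown value at `α = 0` is found by specializing to `α = q`, where the series terminates.
  have hL := qPochInf_mul_qBinCorr hq hq hβ
  have hqq := qPochInf_eq_one_sub_mul q hq
  have hb := qPochInf_eq_one_sub_mul β hq
  rw [qBinCorr_self hq] at hL
  have hL' : qPochInf q q * qBinCorr q 0 1 β q 0 = qPochInf β q := by
    rw [hqq, hb, mul_assoc, hL]; field_simp
  have h := qPochInf_mul_qBinCorr hq hα hβ
  rw [mul_comm q α]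
  linear_combination qPochInf (α * q) q * hL' - qPochInf q q * h

/-! ### Convolutions with a sequence obeying a first-order recurrence. -/

/-- `∑ A i B l c (j - i)` over `i + l = n`, with `A`, `B` the coefficients of
`(α x; q)_∞ / (x; q)_∞` and `(β x; q)_∞ / (x; q)_∞`. -/
noncomputable def qBinConv (q α β : ℂ) (c : ℤ → ℂ) (n : ℕ) (j : ℤ) : ℂ :=
  ∑ p ∈ Finset.HasAntidiagonal.antidiagonal n, qBinCoeff q 1 α p.1 * qBinCoeff q 1 β p.2 * c (j - p.1)

theorem qBinConv_zero (q α β : ℂ) (c : ℤ → ℂ) (j : ℤ) : qBinConv q α β c 0 j = c j := by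
  simp [qBinConv, qBinCoeff_zero]

theorem qBinConv_one {q : ℂ} (hq : ‖q‖ < 1) (α β : ℂ) (c : ℤ → ℂ) (j : ℤ) :
    (1 - q) * qBinConv q α β c 1 j = (1 - α) * c (j - 1) + (1 - β) * c j := by
  have h1 : 1 - q ≠ 0 := by simpa using one_sub_pow_succ_ne_zero hq 0
  simp only [qBinConv, Finset.Nat.sum_antidiagonal_succ, Finset.Nat.antidiagonal_zero,
    Finset.sum_singleton, qBinCoeff_zero, zero_add, qBinCoeff_one, Nat.cast_zero, Nat.cast_one,
    sub_zero]
  field_simp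
  ring

/-- The sequence `f` shifted by one place to the right. -/
def shiftRight (f : ℕ → ℂ) : ℕ → ℂ
  | 0 => 0
  | k + 1 => f k

/-- Let `G(z)` be the generating function in `n`, and let `x` denote the shift `j ↦ j - 1`. The
recurrence is the coefficient of `z ^ (n + 2)` in `(1 - x z)(1 - z) G(z) = (1 - α x z)(1 - β z) G(q
z)`. -/
theorem qBinConv_succ_succ {q : ℂ} (hq : ‖q‖ < 1) (α β : ℂ) (c : ℤ → ℂ) (n : ℕ) (j : ℤ) :
    (1 - q ^ (n + 2)) * qBinConv q α β c (n + 2) j =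
      (1 - α * q ^ (n + 1)) * qBinConv q α β c (n + 1) (j - 1) +
      (1 - β * q ^ (n + 1)) * qBinConv q α β c (n + 1) j -
      (1 - α * β * q ^ n) * qBinConv q α β c n (j - 1) := by
  set A := qBinCoeff q 1 α with hA
  set B := qBinCoeff q 1 β with hB
  have e1 : qBinConv q α β c (n + 1) (j - 1) =
      ∑ p ∈ Finset.HasAntidiagonal.antidiagonal (n + 2), shiftRight A p.1 * B p.2 * c (j - p.1) := by
    rw [Finset.Nat.sum_antidiagonal_succ]
    simp only [shiftRight, zero_mul, zero_add, qBinConv]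
    exact Finset.sum_congr rfl fun p _ => by rw [hA, hB]; push_cast; ring_nf
  have e2 : qBinConv q α β c (n + 1) j =
      ∑ p ∈ Finset.HasAntidiagonal.antidiagonal (n + 2), A p.1 * shiftRight B p.2 * c (j - p.1) := by
    rw [Finset.Nat.sum_antidiagonal_succ']
    simp only [shiftRight, mul_zero, zero_mul, zero_add, qBinConv, hA, hB]
  have e3 : qBinConv q α β c n (j - 1) =
      ∑ p ∈ Finset.HasAntidiagonal.antidiagonal (n + 2),
        shiftRight A p.1 * shiftRight B p.2 * c (j - p.1) := by
    rw [Finset.Nat.sum_antidiagonal_succ, Finset.Nat.sum_antidiagonal_succ']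
    simp only [shiftRight, mul_zero, zero_mul, zero_add, qBinConv]
    exact Finset.sum_congr rfl fun p _ => by rw [hA, hB]; push_cast; ring_nf
  rw [e1, e2, e3, qBinConv, Finset.mul_sum, Finset.mul_sum, Finset.mul_sum, Finset.mul_sum,
    ← Finset.sum_add_distrib, ← Finset.sum_sub_distrib]
  refine Finset.sum_congr rfl fun p hp => ?_
  obtain ⟨i, l⟩ := p
  rw [Finset.HasAntidiagonal.mem_antidiagonal] at hp
  dsimp only at hp ⊢
  rcases i with _ | i
  · obtain rfl : l = n + 2 := by omega
    have h := qBinCoeff_succ hq 1 β (n + 1)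
    simp only [shiftRight]
    linear_combination A 0 * c (j - (0 : ℕ)) * h
  · rcases l with _ | l
    · obtain rfl : i = n + 1 := by omega
      have h := qBinCoeff_succ hq 1 α (n + 1)
      simp only [shiftRight]
      linear_combination B 0 * c (j - (n + 1 + 1 : ℕ)) * h
    · obtain rfl : n = i + l := by omega
      have h1 := qBinCoeff_succ hq 1 α i
      have h2 := qBinCoeff_succ hq 1 β l
      rw [← hA] at h1
      rw [← hB] at h2
      simp only [shiftRight]
      generalize c (j - (i + 1 : ℕ)) = x
      linear_combination x * (B (l + 1) * h1 + q ^ (i + 1) * A (i + 1) * h2 -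
        α * q ^ i * A i * h2 - B l * h1)

/-- The closed form of `qBinConv` divided by its seed. -/
noncomputable def qBinConvRatio (q α β x : ℂ) (n : ℕ) : ℂ :=
  qPoch (α * β) q n / qPoch q q n * (qPoch x q n / qPoch (α * x) q n)

theorem qBinConvRatio_succ {q α x : ℂ} (β : ℂ) (n : ℕ) (hq : ‖q‖ < 1)
    (hx : ‖α * x‖ < 1) :
    (1 - q ^ (n + 1)) * (1 - α * x * q ^ n) * qBinConvRatio q α β x (n + 1) =
      (1 - α * β * q ^ n) * (1 - x * q ^ n) * qBinConvRatio q α β x n := by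
  have h1 := one_sub_pow_succ_ne_zero hq n
  have h2 := qPoch_ne_zero hq hq n
  have h3 := qPoch_ne_zero hq hx n
  have h4 := one_sub_mul_pow_ne_zero hq hx n
  simp only [qBinConvRatio, qPoch_succ, ← pow_succ' q n]
  field_simp

theorem qPoch_shift (x q : ℂ) (n : ℕ) : (1 - x) * qPoch (x * q) q n = qPoch x q (n + 1) := by
  rw [qPoch, qPoch, Finset.prod_range_succ', pow_zero, mul_one, mul_comm]
  congr 1
  exact Finset.prod_congr rfl fun k _ => by ring

/-- The closed form obeys the recurrence of `qBinConv`; `C` and `C'` stand for neighbouring values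
of `c`, and `hC` for its first-order recurrence. -/
theorem qBinConvRatio_succ_succ {q α x : ℂ} (β : ℂ) {C C' : ℂ} (n : ℕ) (hq : ‖q‖ < 1)
    (hx : ‖α * x‖ < 1) (hC : C' * (1 - α * x) = C * (β - x)) :
    (1 - q ^ (n + 2)) * (C * qBinConvRatio q α β x (n + 2)) =
      (1 - α * q ^ (n + 1)) * (C' * qBinConvRatio q α β (x * q) (n + 1)) +
      (1 - β * q ^ (n + 1)) * (C * qBinConvRatio q α β x (n + 1)) -
      (1 - α * β * q ^ n) * (C' * qBinConvRatio q α β (x * q) n) := by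
  have hxq : ‖α * x * q‖ < 1 := by simpa using norm_mul_pow_lt_one hq hx 1
  have h1 := one_sub_pow_succ_ne_zero hq n
  have h1' := one_sub_pow_succ_ne_zero hq (n + 1)
  have h2 := qPoch_ne_zero hq hq n
  have h3 := qPoch_ne_zero hq hxq n
  have h4 := one_sub_mul_pow_ne_zero hq hxq n
  have h5 : 1 - α * x ≠ 0 := by simpa using one_sub_mul_pow_ne_zero hq hx 0
  have hC' : C' = C * (β - x) / (1 - α * x) := by rw [eq_div_iff h5, hC]
  simp only [qBinConvRatio, ← mul_assoc α x q]
  -- Everything is brought to the base points `x * q` and `α * x * q` at length `n`, which reduces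
  -- the claim to a rational identity.
  rw [show n + 2 = n + 1 + 1 from rfl, ← qPoch_shift x, ← qPoch_shift (α * x),
    ← qPoch_shift x, ← qPoch_shift (α * x), hC']
  simp only [qPoch_succ, ← pow_succ' q]
  generalize qPoch (x * q) q n = P at *
  generalize qPoch (α * x * q) q n = Q at *
  generalize qPoch (α * β) q n = M at *
  generalize qPoch q q n = N at *
  simp only [pow_succ] at *
  generalize q ^ n = y at *
  generalize hw : 1 - α * x * q * y = w at *
  generalize hu : 1 - y * q = u at *
  generalize hv : 1 - y * q * q = v at *
  generalize hd : 1 - α * x = d at *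
  field_simp
  subst hw hu hv hd
  ring

theorem qBinConvRatio_one {q α x : ℂ} (β : ℂ) {C C' : ℂ} (hq : ‖q‖ < 1)
    (hx : ‖α * x‖ < 1) (hC : C' * (1 - α * x) = C * (β - x)) :
    (1 - q) * (C * qBinConvRatio q α β x 1) = (1 - α) * C' + (1 - β) * C := by
  have h1 : 1 - q ≠ 0 := by simpa using one_sub_pow_succ_ne_zero hq 0
  have h5 : 1 - α * x ≠ 0 := by simpa using one_sub_mul_pow_ne_zero hq hx 0
  have hC' : C' = C * (β - x) / (1 - α * x) := by rw [eq_div_iff h5, hC]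
  simp only [qBinConvRatio, qPoch, Finset.prod_range_one, pow_zero, mul_one]
  rw [hC']
  field_simp
  ring

theorem qBinConvRatio_zero (q α β x : ℂ) : qBinConvRatio q α β x 0 = 1 := by
  simp [qBinConvRatio, qPoch_zero]

/-- The recurrence at `-m` involves only `-m` and `-m - 1`, so the induction on `n` never leaves the
half-line `j ≤ 0`. -/
theorem qBinConv_neg {q α β : ℂ} {c : ℤ → ℂ} (hq : ‖q‖ < 1) (hα : ‖α‖ < 1)
    (hneg : ∀ m : ℕ, c (-m - 1) * (1 - α * q ^ (m + 1)) = c (-m) * (β - q ^ (m + 1)))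
    (n m : ℕ) :
    qBinConv q α β c n (-m) = c (-m) * qBinConvRatio q α β (q ^ (m + 1)) n := by
  induction n using Nat.twoStepInduction generalizing m with
  | zero => rw [qBinConv_zero, qBinConvRatio_zero, mul_one]
  | one =>
    have h1 : 1 - q ≠ 0 := by simpa using one_sub_pow_succ_ne_zero hq 0
    refine mul_left_cancel₀ h1 ?_
    rw [qBinConv_one hq, qBinConvRatio_one β hq (norm_mul_pow_lt_one hq hα _) (hneg m)]
  | more n ih1 ih2 =>
    refine mul_left_cancel₀ (one_sub_pow_succ_ne_zero hq (n + 1)) ?_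
    have e : (-m - 1 : ℤ) = -((m + 1 : ℕ) : ℤ) := by push_cast; ring
    rw [qBinConv_succ_succ hq, e, ih1, ih2, ih2, ← e,
      qBinConvRatio_succ_succ β n hq (norm_mul_pow_lt_one hq hα _) (hneg m), ← pow_succ]

/-- The mirror image of `qBinConv_neg` under `j ↦ n + 1 - j`, `c ↦ c (1 - ·)`, `α ↔ β`. -/
theorem qBinConv_add {q α β : ℂ} {c : ℤ → ℂ} (hq : ‖q‖ < 1) (hβ : ‖β‖ < 1)
    (hpos : ∀ m : ℕ, c (m + 1) * (1 - β * q ^ m) = c m * (α - q ^ m))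
    (n m : ℕ) :
    qBinConv q α β c n (n + m + 1) = c (m + 1) * qBinConvRatio q β α (q ^ (m + 1)) n := by
  have hp : ∀ m : ℕ, c (m + 1 + 1) * (1 - β * q ^ (m + 1)) = c (m + 1) * (α - q ^ (m + 1)) :=
    fun m => by simpa using hpos (m + 1)
  induction n using Nat.twoStepInduction generalizing m with
  | zero => rw [qBinConv_zero, qBinConvRatio_zero, mul_one]; simp
  | one =>
    have h1 : 1 - q ≠ 0 := by simpa using one_sub_pow_succ_ne_zero hq 0
    refine mul_left_cancel₀ h1 ?_
    rw [qBinConv_one hq, qBinConvRatio_one α hq (norm_mul_pow_lt_one hq hβ _) (hp m)]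
    have e1 : ((1 : ℕ) + m + 1 - 1 : ℤ) = m + 1 := by push_cast; ring
    have e2 : ((1 : ℕ) + m + 1 : ℤ) = m + 1 + 1 := by push_cast; ring
    rw [e1, e2]; ring
  | more n ih1 ih2 =>
    refine mul_left_cancel₀ (one_sub_pow_succ_ne_zero hq (n + 1)) ?_
    have e1 : (((n + 2 : ℕ) : ℤ) + m + 1) = (n + 1 : ℕ) + (m + 1 : ℕ) + 1 := by push_cast; ring
    have e2 : (((n + 1 : ℕ) : ℤ) + (m + 1 : ℕ) + 1 - 1) = (n + 1 : ℕ) + m + 1 := by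
      push_cast; ring
    have e3 : (((n + 1 : ℕ) : ℤ) + m + 1) = n + (m + 1 : ℕ) + 1 := by push_cast; ring
    have i1 := ih1 (m + 1)
    rw [← e3] at i1
    rw [e1, qBinConv_succ_succ hq, e2, ih2 m, ih2 (m + 1), i1,
      qBinConvRatio_succ_succ α n hq (norm_mul_pow_lt_one hq hβ _) (hp m), ← pow_succ]
    push_cast
    ring

theorem qBinConv_eq_zero {q α β : ℂ} {c : ℤ → ℂ} (hq : ‖q‖ < 1) (hα : ‖α‖ < 1) (hβ : ‖β‖ < 1)
    (hpos : ∀ m : ℕ, c (m + 1) * (1 - β * q ^ m) = c m * (α - q ^ m))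
    (hneg : ∀ m : ℕ, c (-m - 1) * (1 - α * q ^ (m + 1)) = c (-m) * (β - q ^ (m + 1)))
    (n : ℕ) (j : ℤ) (h1 : 1 ≤ j) (hn : j ≤ n) :
    qBinConv q α β c n j = 0 := by
  induction n using Nat.twoStepInduction generalizing j with
  | zero => push_cast at hn; omega
  | one =>
    obtain rfl : j = 1 := by push_cast at hn; omega
    have h1 : 1 - q ≠ 0 := by simpa using one_sub_pow_succ_ne_zero hq 0
    refine mul_left_cancel₀ h1 ?_
    rw [qBinConv_one hq]
    have := hpos 0
    simp only [Nat.cast_zero, zero_add, pow_zero, mul_one] at this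
    rw [sub_self]
    linear_combination this
  | more n ih1 ih2 =>
    refine mul_left_cancel₀ (one_sub_pow_succ_ne_zero hq (n + 1)) ?_
    rw [qBinConv_succ_succ hq, mul_zero]
    have hne := one_sub_pow_succ_ne_zero hq n
    push_cast at hn ih1 ih2
    -- Strictly inside the range all three terms vanish by induction. At `j = 1` and `j = n + 2` two
    -- closed forms with `x = q` remain, and they cancel because `1 - x * q ^ n` is then `1 - q ^ (n
    -- + 1)`.
    rcases eq_or_lt_of_le h1 with rfl | h1
    · rw [ih2 1 le_rfl (by omega), sub_self]
      have i0 := qBinConv_neg hq hα hneg n 0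
      have i1 := qBinConv_neg hq hα hneg (n + 1) 0
      have r := qBinConvRatio_succ (α := α) β n hq (norm_mul_pow_lt_one hq hα 1)
      simp only [Nat.cast_zero, neg_zero, zero_add] at i0 i1
      rw [i0, i1]
      refine mul_left_cancel₀ hne ?_
      linear_combination c 0 * r
    · rcases eq_or_lt_of_le hn with rfl | hn
      · have i0 := qBinConv_add hq hβ hpos n 0
        have i1 := qBinConv_add hq hβ hpos (n + 1) 0
        have r := qBinConvRatio_succ (α := β) α n hq (norm_mul_pow_lt_one hq hβ 1)
        have e1 : ((n : ℤ) + 2) = ((n + 1 : ℕ) : ℤ) + (0 : ℕ) + 1 := by push_cast; ring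
        have e2 : ((n : ℤ) + 2 - 1) = (n : ℤ) + (0 : ℕ) + 1 := by push_cast; ring
        rw [ih2 (n + 2 - 1) (by omega) (by omega), e2, e1, i0, i1]
        simp only [Nat.cast_zero, zero_add]
        refine mul_left_cancel₀ hne ?_
        linear_combination c 1 * r
      · rw [ih2 _ (by omega) (by omega), ih2 _ (by omega) (by omega),
          ih1 _ (by omega) (by omega)]
        ring

/-- The diagonal value: only the two extreme terms of the sum survive. -/
theorem sum_qBinConv_sub {q α β : ℂ} {c : ℤ → ℂ} (hq : ‖q‖ < 1) (hα : ‖α‖ < 1) (hβ : ‖β‖ < 1)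
    (hpos : ∀ m : ℕ, c (m + 1) * (1 - β * q ^ m) = c m * (α - q ^ m))
    (hneg : ∀ m : ℕ, c (-m - 1) * (1 - α * q ^ (m + 1)) = c (-m) * (β - q ^ (m + 1)))
    (n : ℕ) :
    ∑ p ∈ Finset.HasAntidiagonal.antidiagonal n, qBinCoeff q 1 α p.1 * qBinCoeff q 1 β p.2 *
        (qBinConv q α β c n p.2 - qBinConv q α β c n (p.2 + 1)) =
      c 0 * (1 - α) * ((1 / (1 - α * q ^ n) + 1 / (1 - β * q ^ n)) *
        (qPoch (α * β) q n / qPoch q q n)) := by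
  have hz := qBinConv_eq_zero hq hα hβ hpos hneg n
  have f1 : ∑ p ∈ Finset.HasAntidiagonal.antidiagonal n, qBinCoeff q 1 α p.1 * qBinCoeff q 1 β p.2 *
      qBinConv q α β c n p.2 = qBinCoeff q 1 α n * qBinConv q α β c n 0 := by
    rw [Finset.sum_eq_single_of_mem (n, 0) (by simp)]
    · simp [qBinCoeff_zero]
    · rintro ⟨i, l⟩ hp hne
      rw [Finset.HasAntidiagonal.mem_antidiagonal] at hp
      have : l ≠ 0 := fun h => hne (by simp_all)
      dsimp only at hp ⊢
      rw [hz l (by omega) (by omega), mul_zero]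
  have f2 : ∑ p ∈ Finset.HasAntidiagonal.antidiagonal n, qBinCoeff q 1 α p.1 * qBinCoeff q 1 β p.2 *
      qBinConv q α β c n (p.2 + 1) = qBinCoeff q 1 β n * qBinConv q α β c n (n + 1) := by
    rw [Finset.sum_eq_single_of_mem (0, n) (by simp)]
    · simp [qBinCoeff_zero]
    · rintro ⟨i, l⟩ hp hne
      rw [Finset.HasAntidiagonal.mem_antidiagonal] at hp
      have : i ≠ 0 := fun h => hne (by simp_all)
      dsimp only at hp ⊢
      rw [hz (l + 1) (by omega) (by omega), mul_zero]
  have g1 := qBinConv_neg hq hα hneg n 0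
  have g2 := qBinConv_add hq hβ hpos n 0
  have h0 := hpos 0
  simp only [Nat.cast_zero, neg_zero, zero_add, add_zero, pow_one, pow_zero, mul_one] at g1 g2 h0
  simp only [mul_sub, Finset.sum_sub_distrib]
  rw [f1, f2, g1, g2]
  have n1 := qPoch_ne_zero hq hq n
  have n2 := one_sub_mul_pow_ne_zero hq hα n
  have n3 := one_sub_mul_pow_ne_zero hq hβ n
  have n4 := qPoch_ne_zero hq (by simpa using norm_mul_pow_lt_one hq hα 1 : ‖α * q‖ < 1) n
  have n5 := qPoch_ne_zero hq (by simpa using norm_mul_pow_lt_one hq hβ 1 : ‖β * q‖ < 1) n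
  have n6 : 1 - β ≠ 0 := by simpa using one_sub_mul_pow_ne_zero hq hβ 0
  have e1 := qPoch_shift α q n
  have e2 := qPoch_shift β q n
  rw [qPoch_succ] at e1 e2
  have a1 : qPoch α q n / qPoch (α * q) q n = (1 - α) / (1 - α * q ^ n) := by
    rw [div_eq_div_iff n4 n2, e1]
  have a2 : qPoch β q n / qPoch (β * q) q n = (1 - β) / (1 - β * q ^ n) := by
    rw [div_eq_div_iff n5 n3, e2]
  have c1 : c 1 = c 0 * (α - 1) / (1 - β) := by rw [eq_div_iff n6, h0]
  have t1 : qBinCoeff q 1 α n * (c 0 * qBinConvRatio q α β q n) =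
      c 0 * (qPoch (α * β) q n / qPoch q q n) * (qPoch α q n / qPoch (α * q) q n) := by
    rw [qBinCoeff_one_left, qBinConvRatio]; field_simp
  have t2 : qBinCoeff q 1 β n * (c 1 * qBinConvRatio q β α q n) =
      c 1 * (qPoch (α * β) q n / qPoch q q n) * (qPoch β q n / qPoch (β * q) q n) := by
    rw [qBinCoeff_one_left, qBinConvRatio, mul_comm β α]; field_simp
  rw [t1, t2, a1, a2, c1]
  field_simp
  ring

/-! ### Fourier integrals on the circle. -/

/-- The character `θ ↦ exp (i k θ)`. -/
noncomputable def circleChar (k : ℤ) (θ : ℝ) : ℂ := Complex.exp (k * (Complex.I * θ))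

theorem continuous_circleChar (k : ℤ) : Continuous (circleChar k) := by
  unfold circleChar; fun_prop

theorem norm_circleChar (k : ℤ) (θ : ℝ) : ‖circleChar k θ‖ = 1 := by
  have : (k : ℂ) * (Complex.I * θ) = ((k * θ : ℝ) : ℂ) * Complex.I := by push_cast; ring
  rw [circleChar, this, Complex.norm_exp_ofReal_mul_I]

theorem circleChar_add (k l : ℤ) (θ : ℝ) :
    circleChar (k + l) θ = circleChar k θ * circleChar l θ := by
  rw [circleChar, circleChar, circleChar, ← Complex.exp_add]
  push_cast; ring_nf

theorem circleChar_zero (θ : ℝ) : circleChar 0 θ = 1 := by simp [circleChar]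

theorem circleChar_pow (k : ℤ) (n : ℕ) (θ : ℝ) :
    circleChar k θ ^ n = circleChar (k * n) θ := by
  rw [circleChar, circleChar, ← Complex.exp_nat_mul]
  push_cast; ring_nf

theorem integral_circleChar (k : ℤ) :
    ∫ θ in (0 : ℝ)..(2 * Real.pi), circleChar k θ = if k = 0 then 2 * (Real.pi : ℂ) else 0 := by
  split_ifs with h
  · subst h
    simp [circleChar_zero]
  · have hk : (k : ℂ) * Complex.I ≠ 0 := mul_ne_zero (by exact_mod_cast h) Complex.I_ne_zero
    have e : ∀ θ : ℝ, circleChar k θ = Complex.exp (k * Complex.I * θ) := fun θ => by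
      rw [circleChar, mul_assoc]
    simp only [e]
    rw [integral_exp_mul_complex hk]
    have : (k : ℂ) * Complex.I * ((2 * Real.pi : ℝ) : ℂ) = k * (2 * Real.pi * Complex.I) := by
      push_cast; ring
    rw [this, Complex.exp_int_mul_two_pi_mul_I]
    simp

theorem hasSum_integral_tsum_mul {g : ℕ → ℝ → ℂ} {F : ℝ → ℂ} {M : ℕ → ℝ}
    (hF : Continuous F) (hg : ∀ n, Continuous (g n)) (hM : Summable M)
    (hb : ∀ n θ, ‖g n θ‖ ≤ M n) :
    HasSum (fun n => ∫ θ in (0 : ℝ)..(2 * Real.pi), g n θ * F θ)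
      (∫ θ in (0 : ℝ)..(2 * Real.pi), (∑' n, g n θ) * F θ) := by
  refine intervalIntegral.hasSum_integral_of_dominated_convergence
    (fun n θ => M n * ‖F θ‖) ?_ ?_ ?_ ?_ ?_
  · exact fun n => ((hg n).mul hF).aestronglyMeasurable
  · refine fun n => Eventually.of_forall fun θ _ => ?_
    rw [norm_mul]
    exact mul_le_mul_of_nonneg_right (hb n θ) (norm_nonneg _)
  · exact Eventually.of_forall fun θ _ => hM.mul_right _
  · simp only [tsum_mul_right]
    exact (continuous_const.mul hF.norm).intervalIntegrable _ _
  · refine Eventually.of_forall fun θ _ => ?_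
    exact (Summable.of_norm_bounded hM fun n => hb n θ).hasSum.mul_right _

/-- The function on the circle with Fourier coefficient `a m` at the frequency `σ m`. -/
noncomputable def circleSeries (σ : ℤ) (a : ℕ → ℂ) (θ : ℝ) : ℂ :=
  ∑' m : ℕ, a m * circleChar (σ * m) θ

theorem norm_mul_circleChar (z : ℂ) (k : ℤ) (θ : ℝ) : ‖z * circleChar k θ‖ = ‖z‖ := by
  rw [norm_mul, norm_circleChar, mul_one]

theorem continuous_circleSeries (σ : ℤ) {a : ℕ → ℂ} (ha : Summable fun m => ‖a m‖) :
    Continuous (circleSeries σ a) :=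
  continuous_tsum (fun _ => continuous_const.mul (continuous_circleChar _)) ha
    fun _ θ => (norm_mul_circleChar _ _ θ).le

theorem integral_circleSeries_mul (σ : ℤ) {a : ℕ → ℂ} (ha : Summable fun m => ‖a m‖)
    {F : ℝ → ℂ} (hF : Continuous F) :
    ∫ θ in (0 : ℝ)..(2 * Real.pi), circleSeries σ a θ * F θ =
      ∑' m : ℕ, a m * ∫ θ in (0 : ℝ)..(2 * Real.pi), circleChar (σ * m) θ * F θ := by
  have h := hasSum_integral_tsum_mul hF
    (fun m => continuous_const.fun_mul (continuous_circleChar (σ * m))) ha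
    fun m θ => (norm_mul_circleChar (a m) _ θ).le
  simp only [circleSeries]
  rw [← h.tsum_eq]
  refine tsum_congr fun m => ?_
  simp only [mul_assoc]
  exact intervalIntegral.integral_const_mul _ _

theorem integral_circleSeries_mul_char (σ k : ℤ) {b : ℕ → ℂ} (hb : Summable fun m => ‖b m‖) :
    ∫ θ in (0 : ℝ)..(2 * Real.pi), circleSeries σ b θ * circleChar k θ =
      ∑' l : ℕ, b l * if σ * l + k = 0 then 2 * (Real.pi : ℂ) else 0 := by
  rw [integral_circleSeries_mul σ hb (continuous_circleChar k)]
  simp only [← circleChar_add, integral_circleChar]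

theorem integral_circleSeries_mul_mul (σ k : ℤ) {a b : ℕ → ℂ}
    (ha : Summable fun m => ‖a m‖) (hb : Summable fun m => ‖b m‖) :
    ∫ θ in (0 : ℝ)..(2 * Real.pi), circleChar k θ * (circleSeries σ a θ * circleSeries (-σ) b θ) =
      ∑' m : ℕ, a m * ∑' l : ℕ, b l *
        if -σ * l + (σ * m + k) = 0 then 2 * (Real.pi : ℂ) else 0 := by
  have hB := continuous_circleSeries (-σ) hb
  have e : ∀ θ, circleChar k θ * (circleSeries σ a θ * circleSeries (-σ) b θ) =
      circleSeries σ a θ * (circleSeries (-σ) b θ * circleChar k θ) := fun θ => by ring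
  simp only [e]
  rw [integral_circleSeries_mul σ ha (hB.fun_mul (continuous_circleChar k))]
  refine tsum_congr fun m => ?_
  rw [← integral_circleSeries_mul_char _ _ hb]
  congr 2
  ext θ
  rw [circleChar_add]
  ring

theorem integral_circleSeries_corr {σ : ℤ} (hσ : σ ≠ 0) (J : ℕ) {a b : ℕ → ℂ}
    (ha : Summable fun m => ‖a m‖) (hb : Summable fun m => ‖b m‖) :
    ∫ θ in (0 : ℝ)..(2 * Real.pi),
        circleChar (σ * J) θ * (circleSeries σ a θ * circleSeries (-σ) b θ) =
      2 * (Real.pi : ℂ) * ∑' m : ℕ, b (m + J) * a m := by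
  rw [integral_circleSeries_mul_mul σ _ ha hb, ← tsum_mul_left]
  refine tsum_congr fun m => ?_
  rw [tsum_eq_single (m + J)]
  · rw [if_pos (by push_cast; ring)]; ring
  · intro l hl
    rw [if_neg, mul_zero]
    intro h
    have h' : σ * ((m + J : ℤ) - l) = 0 := by linear_combination h
    rcases mul_eq_zero.1 h' with h' | h'
    · exact hσ h'
    · exact hl (by omega)

/-! ### Fourier coefficients of `qPsi`. -/

/-- The Laurent coefficients of `(u, q / u; q)_∞ / (α u, β / u; q)_∞`. -/
noncomputable def qPsiCoeff (q α β : ℂ) : ℤ → ℂ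
  | Int.ofNat m => qBinCorr q α 1 β q m
  | Int.negSucc m => qBinCorr q β q α 1 (m + 1)

theorem qPsiCoeff_natCast (q α β : ℂ) (m : ℕ) :
    qPsiCoeff q α β m = qBinCorr q α 1 β q m := rfl

theorem qPsiCoeff_neg (q α β : ℂ) (m : ℕ) :
    qPsiCoeff q α β (-m) = qBinCorr q β q α 1 m := by
  cases m with
  | zero => exact qBinCorr_zero_swap q α 1 β q
  | succ m => rfl

/-- The function `(u, q / u; q)_∞ / (α u, β / u; q)_∞` at `u = exp (2 i θ)`. -/
noncomputable def qPsi (q α β : ℂ) (θ : ℝ) : ℂ :=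
  circleSeries 2 (qBinCoeff q α 1) θ * circleSeries (-2) (qBinCoeff q β q) θ

theorem continuous_qPsi {q α β : ℂ} (hq : ‖q‖ < 1) (hα : ‖α‖ < 1) (hβ : ‖β‖ < 1) : Continuous (qPsi q α β) :=
  (continuous_circleSeries _ (summable_norm_qBinCoeff hq hα 1)).mul
    (continuous_circleSeries _ (summable_norm_qBinCoeff hq hβ q))

theorem integral_char_mul_qPsi {q α β : ℂ} (hq : ‖q‖ < 1) (hα : ‖α‖ < 1) (hβ : ‖β‖ < 1)
    (j : ℤ) :
    ∫ θ in (0 : ℝ)..(2 * Real.pi), circleChar (-2 * j) θ * qPsi q α β θ =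
      2 * (Real.pi : ℂ) * qPsiCoeff q α β j := by
  have ha := summable_norm_qBinCoeff hq hα 1
  have hb := summable_norm_qBinCoeff hq hβ q
  obtain ⟨m, rfl | rfl⟩ := j.eq_nat_or_neg
  · rw [qPsiCoeff_natCast, qBinCorr, ← integral_circleSeries_corr (by norm_num : (-2 : ℤ) ≠ 0) m hb ha]
    simp only [qPsi, neg_neg, mul_comm]
  · rw [qPsiCoeff_neg, qBinCorr, ← integral_circleSeries_corr (by norm_num : (2 : ℤ) ≠ 0) m ha hb]
    simp only [qPsi, neg_mul_neg]

theorem integral_char_mul_qPsi_of_odd {q α β : ℂ} (hq : ‖q‖ < 1) (hα : ‖α‖ < 1) (hβ : ‖β‖ < 1)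
    {k : ℤ} (hk : Odd k) :
    ∫ θ in (0 : ℝ)..(2 * Real.pi), circleChar k θ * qPsi q α β θ = 0 := by
  unfold qPsi
  rw [integral_circleSeries_mul_mul 2 k (summable_norm_qBinCoeff hq hα 1)
    (summable_norm_qBinCoeff hq hβ q)]
  have : ∀ m l : ℕ, ¬ (-2 * (l : ℤ) + (2 * m + k) = 0) := by
    obtain ⟨r, rfl⟩ := hk
    intro m l; omega
  simp only [if_neg (this _ _), mul_zero, tsum_zero]

theorem qPsiCoeff_succ {q α β : ℂ} (hq : ‖q‖ < 1) (hα : ‖α‖ < 1) (hβ : ‖β‖ < 1)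
    (m : ℕ) :
    qPsiCoeff q α β (m + 1) * (1 - β * q ^ m) = qPsiCoeff q α β m * (α - q ^ m) := by
  have h := qBinCorr_succ hq hα hβ (one_mul q) m
  rw [mul_one, one_mul] at h
  exact h

theorem qPsiCoeff_neg_sub_one {q α β : ℂ} (hq : ‖q‖ < 1) (hα : ‖α‖ < 1) (hβ : ‖β‖ < 1)
    (m : ℕ) :
    qPsiCoeff q α β (-m - 1) * (1 - α * q ^ (m + 1)) =
      qPsiCoeff q α β (-m) * (β - q ^ (m + 1)) := by
  have h := qBinCorr_succ hq hβ hα (mul_one q) m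
  have e : (-m - 1 : ℤ) = -((m + 1 : ℕ) : ℤ) := by push_cast; ring
  rw [e, qPsiCoeff_neg, qPsiCoeff_neg, pow_succ', ← mul_assoc]
  exact h

/-! ### Orthogonality of the trigonometric polynomials. -/

/-- The trigonometric polynomial `∑ A i B l exp (i (i - l) θ)` over `i + l = n`. -/
noncomputable def trigPoly (q α β : ℂ) (n : ℕ) (θ : ℝ) : ℂ :=
  ∑ p ∈ Finset.HasAntidiagonal.antidiagonal n,
    qBinCoeff q 1 α p.1 * qBinCoeff q 1 β p.2 * circleChar (p.1 - p.2) θ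

theorem continuous_trigPoly (q α β : ℂ) (n : ℕ) : Continuous (trigPoly q α β n) :=
  continuous_finsetSum _ fun _ _ => continuous_const.fun_mul (continuous_circleChar _)

theorem integral_trigPoly_mul (q α β : ℂ) (n : ℕ) {F : ℝ → ℂ} (hF : Continuous F) :
    ∫ θ in (0 : ℝ)..(2 * Real.pi), trigPoly q α β n θ * F θ =
      ∑ p ∈ Finset.HasAntidiagonal.antidiagonal n, qBinCoeff q 1 α p.1 * qBinCoeff q 1 β p.2 *
        ∫ θ in (0 : ℝ)..(2 * Real.pi), circleChar (p.1 - p.2) θ * F θ := by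
  simp only [trigPoly, Finset.sum_mul, mul_assoc]
  rw [intervalIntegral.integral_finsetSum]
  · simp only [intervalIntegral.integral_const_mul]
  · intro p _
    exact (continuous_const.fun_mul (continuous_const.mul
      ((continuous_circleChar _).fun_mul hF))).intervalIntegrable _ _

theorem integral_trigPoly_mul_qPsi {q α β : ℂ} (hq : ‖q‖ < 1) (hα : ‖α‖ < 1) (hβ : ‖β‖ < 1)
    (n : ℕ) (j : ℤ) :
    ∫ θ in (0 : ℝ)..(2 * Real.pi),
        trigPoly q α β n θ * (circleChar (n - 2 * j) θ * qPsi q α β θ) =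
      2 * (Real.pi : ℂ) * qBinConv q α β (qPsiCoeff q α β) n j := by
  rw [integral_trigPoly_mul _ _ _ _ ((continuous_circleChar _).fun_mul (continuous_qPsi hq hα hβ)),
    qBinConv, Finset.mul_sum]
  refine Finset.sum_congr rfl fun p hp => ?_
  rw [Finset.HasAntidiagonal.mem_antidiagonal] at hp
  have e : ((p.1 : ℤ) - p.2) + (n - 2 * j) = -2 * (j - p.1) := by omega
  simp only [← mul_assoc, ← circleChar_add, e]
  rw [integral_char_mul_qPsi hq hα hβ]
  ring

theorem integral_trigPoly_mul_qPsi_of_odd {q α β : ℂ} (hq : ‖q‖ < 1) (hα : ‖α‖ < 1) (hβ : ‖β‖ < 1)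
    (n : ℕ) {k : ℤ} (hk : Odd (n + k)) :
    ∫ θ in (0 : ℝ)..(2 * Real.pi), trigPoly q α β n θ * (circleChar k θ * qPsi q α β θ) = 0 := by
  rw [integral_trigPoly_mul _ _ _ _ ((continuous_circleChar _).fun_mul (continuous_qPsi hq hα hβ))]
  refine Finset.sum_eq_zero fun p hp => ?_
  rw [Finset.HasAntidiagonal.mem_antidiagonal] at hp
  have ho : Odd (((p.1 : ℤ) - p.2) + k) := by
    obtain ⟨r, hr⟩ := hk
    exact ⟨r - p.2, by omega⟩
  simp only [← mul_assoc, ← circleChar_add]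
  rw [integral_char_mul_qPsi_of_odd hq hα hβ ho, mul_zero]

/-- The weight `(u, 1 / u; q)_∞ / (α u, β / u; q)_∞` at `u = exp (2 i θ)`. -/
noncomputable def qWeight (q α β : ℂ) (θ : ℝ) : ℂ :=
  (1 - circleChar (-2) θ) * qPsi q α β θ

theorem continuous_qWeight {q α β : ℂ} (hq : ‖q‖ < 1) (hα : ‖α‖ < 1) (hβ : ‖β‖ < 1) : Continuous (qWeight q α β) :=
  (continuous_const.sub (continuous_circleChar _)).fun_mul (continuous_qPsi hq hα hβ)

/-- The factor `1 - exp (-2 i θ)` of the weight turns each moment into a difference of two adjacent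
ones. -/
theorem integral_trigPoly_mul_trigPoly {q α β : ℂ} (hq : ‖q‖ < 1) (hα : ‖α‖ < 1) (hβ : ‖β‖ < 1)
    (m n : ℕ) :
    ∫ θ in (0 : ℝ)..(2 * Real.pi),
        trigPoly q α β m θ * (trigPoly q α β n θ * qWeight q α β θ) =
      ∑ p ∈ Finset.HasAntidiagonal.antidiagonal m, qBinCoeff q 1 α p.1 * qBinCoeff q 1 β p.2 *
        ((∫ θ in (0 : ℝ)..(2 * Real.pi),
            trigPoly q α β n θ * (circleChar (p.1 - p.2) θ * qPsi q α β θ)) -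
          ∫ θ in (0 : ℝ)..(2 * Real.pi),
            trigPoly q α β n θ * (circleChar (p.1 - p.2 - 2) θ * qPsi q α β θ)) := by
  have hV := continuous_qPsi hq hα hβ
  have hr := continuous_trigPoly q α β n
  rw [integral_trigPoly_mul _ _ _ _ (hr.fun_mul (continuous_qWeight hq hα hβ))]
  refine Finset.sum_congr rfl fun p _ => ?_
  rw [← intervalIntegral.integral_sub
    ((hr.fun_mul ((continuous_circleChar _).fun_mul hV)).intervalIntegrable _ _)
    ((hr.fun_mul ((continuous_circleChar _).fun_mul hV)).intervalIntegrable _ _)]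
  congr 2
  ext θ
  rw [sub_eq_add_neg ((p.1 : ℤ) - p.2) 2, circleChar_add, qWeight]
  ring

theorem integral_trigPoly_mul_self {q α β : ℂ} (hq : ‖q‖ < 1) (hα : ‖α‖ < 1) (hβ : ‖β‖ < 1)
    (n : ℕ) :
    ∫ θ in (0 : ℝ)..(2 * Real.pi),
        trigPoly q α β n θ * (trigPoly q α β n θ * qWeight q α β θ) =
      2 * (Real.pi : ℂ) * (qPsiCoeff q α β 0 * (1 - α) *
        ((1 / (1 - α * q ^ n) + 1 / (1 - β * q ^ n)) * (qPoch (α * β) q n / qPoch q q n))) := by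
  rw [integral_trigPoly_mul_trigPoly hq hα hβ, ← sum_qBinConv_sub hq hα hβ
    (qPsiCoeff_succ hq hα hβ) (qPsiCoeff_neg_sub_one hq hα hβ) n, Finset.mul_sum]
  refine Finset.sum_congr rfl fun p hp => ?_
  rw [Finset.HasAntidiagonal.mem_antidiagonal] at hp
  have e1 : ((p.1 : ℤ) - p.2) = n - 2 * (p.2 : ℤ) := by omega
  have e2 : ((n : ℤ) - 2 * (p.2 : ℤ) - 2) = n - 2 * ((p.2 : ℤ) + 1) := by omega
  rw [e1, e2, integral_trigPoly_mul_qPsi hq hα hβ, integral_trigPoly_mul_qPsi hq hα hβ]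
  ring

theorem integral_trigPoly_mul_of_lt {q α β : ℂ} (hq : ‖q‖ < 1) (hα : ‖α‖ < 1) (hβ : ‖β‖ < 1)
    {m n : ℕ} (h : m < n) :
    ∫ θ in (0 : ℝ)..(2 * Real.pi),
        trigPoly q α β m θ * (trigPoly q α β n θ * qWeight q α β θ) = 0 := by
  rw [integral_trigPoly_mul_trigPoly hq hα hβ]
  refine Finset.sum_eq_zero fun p hp => ?_
  rw [Finset.HasAntidiagonal.mem_antidiagonal] at hp
  have hz := qBinConv_eq_zero hq hα hβ
    (qPsiCoeff_succ hq hα hβ) (qPsiCoeff_neg_sub_one hq hα hβ) n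
  -- If `n - m = 2 * d` with `d ≥ 1`, the moments needed have indices `p.2 + d` and `p.2 + d + 1`,
  -- both in `[1, n]`. If `n - m` is odd, they vanish because `qPsi` has only even frequencies.
  rcases Int.even_or_odd' ((n : ℤ) - m) with ⟨d, hd | hd⟩
  · have e1 : ((p.1 : ℤ) - p.2) = n - 2 * (p.2 + d) := by omega
    have e2 : ((n : ℤ) - 2 * (p.2 + d) - 2) = n - 2 * (p.2 + d + 1) := by omega
    rw [e1, e2, integral_trigPoly_mul_qPsi hq hα hβ, integral_trigPoly_mul_qPsi hq hα hβ,
      hz _ (by omega) (by omega), hz _ (by omega) (by omega)]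
    ring
  · rw [integral_trigPoly_mul_qPsi_of_odd hq hα hβ n ⟨d + p.1, by omega⟩,
      integral_trigPoly_mul_qPsi_of_odd hq hα hβ n ⟨d + p.1 - 1, by omega⟩]
    ring

theorem integral_trigPoly_mul_of_ne {q α β : ℂ} (hq : ‖q‖ < 1) (hα : ‖α‖ < 1) (hβ : ‖β‖ < 1)
    {m n : ℕ} (h : n ≠ m) :
    ∫ θ in (0 : ℝ)..(2 * Real.pi),
        trigPoly q α β n θ * (trigPoly q α β m θ * qWeight q α β θ) = 0 := by
  rcases lt_or_gt_of_ne h with h | h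
  · exact integral_trigPoly_mul_of_lt hq hα hβ h
  · rw [← integral_trigPoly_mul_of_lt hq hα hβ h]
    congr 1
    ext θ
    ring

/-! ### Generating functions and the evaluation of the integral. -/

theorem qBinCoeff_mul_pow (q α t : ℂ) (k : ℕ) :
    qBinCoeff q t (α * t) k = qBinCoeff q 1 α k * t ^ k := by
  rw [← qBinCoeff_mul, one_mul]

theorem qPochInf_div_circleChar {q a : ℂ} (hq : ‖q‖ < 1) (ha : ‖a‖ < 1) (b : ℂ) (σ : ℤ) (θ : ℝ) :
    qPochInf (b * circleChar σ θ) q / qPochInf (a * circleChar σ θ) q =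
      circleSeries σ (qBinCoeff q a b) θ := by
  rw [qPochInf_div hq ha b (norm_circleChar σ θ)]
  simp only [circleSeries, circleChar_pow]

/-- A majorant of `t ^ n * trigPoly q α β n`. -/
noncomputable def trigPolyBound (q α β t : ℂ) (n : ℕ) : ℝ :=
  ∑ p ∈ Finset.HasAntidiagonal.antidiagonal n,
    ‖qBinCoeff q t (α * t) p.1‖ * ‖qBinCoeff q t (β * t) p.2‖

theorem summable_trigPolyBound {q t : ℂ} (hq : ‖q‖ < 1) (ht : ‖t‖ < 1) (α β : ℂ) :
    Summable (trigPolyBound q α β t) := by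
  refine Summable.of_norm ?_
  unfold trigPolyBound
  refine summable_norm_sum_mul_antidiagonal_of_summable_norm
    (f := fun k => ‖qBinCoeff q t (α * t) k‖) (g := fun k => ‖qBinCoeff q t (β * t) k‖) ?_ ?_
  · simpa only [norm_norm] using summable_norm_qBinCoeff hq ht (α * t)
  · simpa only [norm_norm] using summable_norm_qBinCoeff hq ht (β * t)

theorem pow_mul_trigPoly (q α β t : ℂ) (n : ℕ) (θ : ℝ) :
    t ^ n * trigPoly q α β n θ = ∑ p ∈ Finset.HasAntidiagonal.antidiagonal n,
      qBinCoeff q t (α * t) p.1 * circleChar (1 * p.1) θ *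
        (qBinCoeff q t (β * t) p.2 * circleChar (-1 * p.2) θ) := by
  rw [trigPoly, Finset.mul_sum]
  refine Finset.sum_congr rfl fun p hp => ?_
  rw [Finset.HasAntidiagonal.mem_antidiagonal] at hp
  rw [qBinCoeff_mul_pow, qBinCoeff_mul_pow, one_mul, neg_one_mul, sub_eq_add_neg, circleChar_add,
    ← hp, pow_add]
  ring

theorem norm_pow_mul_trigPoly_le (q α β t : ℂ) (n : ℕ) (θ : ℝ) :
    ‖t ^ n * trigPoly q α β n θ‖ ≤ trigPolyBound q α β t n := by
  rw [pow_mul_trigPoly]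
  refine (norm_sum_le _ _).trans (le_of_eq (Finset.sum_congr rfl fun p _ => ?_))
  rw [norm_mul, norm_mul_circleChar, norm_mul_circleChar]

theorem tsum_pow_mul_trigPoly {q t : ℂ} (hq : ‖q‖ < 1) (ht : ‖t‖ < 1) (α β : ℂ) (θ : ℝ) :
    ∑' n, t ^ n * trigPoly q α β n θ =
      circleSeries 1 (qBinCoeff q t (α * t)) θ * circleSeries (-1) (qBinCoeff q t (β * t)) θ := by
  rw [circleSeries, circleSeries, tsum_mul_tsum_eq_tsum_sum_antidiagonal_of_summable_norm]
  · exact tsum_congr fun n => pow_mul_trigPoly q α β t n θ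
  · simpa only [norm_mul_circleChar] using summable_norm_qBinCoeff hq ht (α * t)
  · simpa only [norm_mul_circleChar] using summable_norm_qBinCoeff hq ht (β * t)

theorem continuous_tsum_pow_mul_trigPoly {q t : ℂ} (hq : ‖q‖ < 1) (ht : ‖t‖ < 1) (α β : ℂ) :
    Continuous fun θ => ∑' n, t ^ n * trigPoly q α β n θ :=
  continuous_tsum (fun n => continuous_const.mul (continuous_trigPoly q α β n))
    (summable_trigPolyBound hq ht α β) fun n θ => norm_pow_mul_trigPoly_le q α β t n θ

theorem qBetaIntegrand_eq {q α β s t : ℂ} (hq : ‖q‖ < 1) (hα : ‖α‖ < 1) (hβ : ‖β‖ < 1)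
    (hs : ‖s‖ < 1) (ht : ‖t‖ < 1) (θ : ℝ) :
    qBetaIntegrand q α β s t θ = (∑' n, t ^ n * trigPoly q α β n θ) *
      ((∑' n, s ^ n * trigPoly q α β n θ) * qWeight q α β θ) := by
  have e1 : Complex.exp (Complex.I * θ) = circleChar 1 θ := by simp [circleChar]
  have e2 : Complex.exp (-(Complex.I * θ)) = circleChar (-1) θ := by simp [circleChar]
  have e3 : circleChar 1 θ ^ 2 = circleChar 2 θ := by rw [circleChar_pow]; norm_num
  have e4 : circleChar (-1) θ ^ 2 = circleChar (-2) θ := by rw [circleChar_pow]; norm_num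
  rw [tsum_pow_mul_trigPoly hq ht, tsum_pow_mul_trigPoly hq hs, qWeight, qPsi]
  simp only [qBetaIntegrand, e1, e2, e3, e4, ← qPochInf_div_circleChar hq ht,
    ← qPochInf_div_circleChar hq hs, ← qPochInf_div_circleChar hq hα,
    ← qPochInf_div_circleChar hq hβ, one_mul]
  -- Splitting off the first factor replaces `1 / u` by `q / u`, so that the numerator parameters
  -- `1` and `q` of `qPsi` have product `q`, as `qBinCorr_succ` demands.
  rw [qPochInf_eq_one_sub_mul (circleChar (-2) θ) hq]
  ring

theorem hasSum_qBetaTerm {q α β s t : ℂ} (hq : ‖q‖ < 1) (hα : ‖α‖ < 1) (hβ : ‖β‖ < 1)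
    (hs : ‖s‖ < 1) (ht : ‖t‖ < 1) :
    HasSum (fun n => 2 * (Real.pi : ℂ) * (qPsiCoeff q α β 0 * (1 - α)) * qBetaTerm q α β s t n)
      (∫ θ in (0 : ℝ)..(2 * Real.pi), qBetaIntegrand q α β s t θ) := by
  have hW := continuous_qWeight hq hα hβ
  have h := hasSum_integral_tsum_mul
    ((continuous_tsum_pow_mul_trigPoly hq hs α β).fun_mul hW)
    (fun n => continuous_const.fun_mul (continuous_trigPoly q α β n))
    (summable_trigPolyBound hq ht α β) fun n θ => norm_pow_mul_trigPoly_le q α β t n θ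
  simp only [← qBetaIntegrand_eq hq hα hβ hs ht] at h
  convert h using 1
  ext m
  have hm := hasSum_integral_tsum_mul
    ((continuous_trigPoly q α β m).fun_mul hW)
    (fun n => continuous_const.fun_mul (continuous_trigPoly q α β n))
    (summable_trigPolyBound hq hs α β) fun n θ => norm_pow_mul_trigPoly_le q α β s n θ
  have e : ∀ θ, t ^ m * trigPoly q α β m θ *
      ((∑' n, s ^ n * trigPoly q α β n θ) * qWeight q α β θ) =
      t ^ m * ((∑' n, s ^ n * trigPoly q α β n θ) *
        (trigPoly q α β m θ * qWeight q α β θ)) := fun θ => by ring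
  simp only [e]
  rw [intervalIntegral.integral_const_mul, ← hm.tsum_eq]
  simp only [mul_assoc (s ^ _), intervalIntegral.integral_const_mul]
  -- Orthogonality leaves only `n = m` in the expansion in powers of `s`.
  rw [tsum_eq_single m fun n hn => by
    rw [integral_trigPoly_mul_of_ne hq hα hβ hn, mul_zero],
    integral_trigPoly_mul_self hq hα hβ, qBetaTerm, mul_pow]
  ring

theorem qPsiCoeff_zero_mul {q α β : ℂ} (hq : ‖q‖ < 1) (hα : ‖α‖ < 1) (hβ : ‖β‖ < 1) :
    qPsiCoeff q α β 0 * (1 - α) =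
      qPochInf α q * qPochInf β q / (qPochInf q q * qPochInf (α * β) q) := by
  have hαβ : ‖α * β‖ < 1 := by
    rw [norm_mul]; nlinarith [norm_nonneg α, norm_nonneg β]
  rw [eq_div_iff (mul_ne_zero (qPochInf_ne_zero hq hq) (qPochInf_ne_zero hq hαβ)),
    qPochInf_eq_one_sub_mul α hq]
  have h := qBinCorr_eq hq hα hβ
  rw [← qPsiCoeff_natCast, Nat.cast_zero] at h
  linear_combination (1 - α) * h

theorem theorem1p4 (q α β s t : ℂ) (hq : ‖q‖ < 1) (hα : ‖α‖ < 1) (hβ : ‖β‖ < 1)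
    (hs : ‖s‖ < 1) (ht : ‖t‖ < 1) :
    IntervalIntegrable (qBetaIntegrand q α β s t) MeasureTheory.volume 0 (2 * Real.pi) ∧
    Summable (qBetaTerm q α β s t) ∧
    ∫ θ in (0 : ℝ)..(2 * Real.pi), qBetaIntegrand q α β s t θ =
      2 * (Real.pi : ℂ) * (qPochInf α q * qPochInf β q) / (qPochInf q q * qPochInf (α * β) q) *
        ∑' n : ℕ, qBetaTerm q α β s t n := by
  have h := hasSum_qBetaTerm hq hα hβ hs ht
  have hαβ : ‖α * β‖ < 1 := by
    rw [norm_mul]; nlinarith [norm_nonneg α, norm_nonneg β]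
  -- Summability is known for a constant multiple of the series, so the constant must be nonzero to
  -- be removed.
  have hC : 2 * (Real.pi : ℂ) * (qPsiCoeff q α β 0 * (1 - α)) ≠ 0 := by
    rw [qPsiCoeff_zero_mul hq hα hβ]
    refine mul_ne_zero (by simp [Real.pi_ne_zero]) (div_ne_zero ?_ ?_)
    · exact mul_ne_zero (qPochInf_ne_zero hq hα) (qPochInf_ne_zero hq hβ)
    · exact mul_ne_zero (qPochInf_ne_zero hq hq) (qPochInf_ne_zero hq hαβ)
  refine ⟨?_, (summable_mul_left_iff hC).1 h.summable, ?_⟩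
  · have hc : Continuous (qBetaIntegrand q α β s t) := by
      rw [funext (qBetaIntegrand_eq hq hα hβ hs ht)]
      exact (continuous_tsum_pow_mul_trigPoly hq ht α β).mul
        ((continuous_tsum_pow_mul_trigPoly hq hs α β).mul (continuous_qWeight hq hα hβ))
    exact hc.intervalIntegrable _ _
  · rw [← h.tsum_eq, tsum_mul_left, qPsiCoeff_zero_mul hq hα hβ]
    ring
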